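/- Let $\beta$ be a quadratic Pisot unit, i.e. a real algebraic integer $\beta>1$ of degree $2$ over $\mathbb{Q}$ whose other conjugate has modulus strictly less than $1$ and whose inverse $\beta^{-1}$ is also an algebraic integer. Let $m$ be a non-negative integer with $m>\beta-1$, and let $$X^m(\beta)=\Big\{\sum_{j=0}^{n}a_j\beta^j \;:\; n\in\mathbb{N},\ a_j\in\{0,1,\dots,m\}\Big\}.$$ Then the points of $X^m(\beta)$ can be listed as a strictly increasing sequence, $X^m(\beta)=\{y_0<y_1<y_2<\cdots\}$, and there exist real numbers $\Delta_1,\Delta_2>0$ such that $$y_{k+1}-y_k\in\{\Delta_1,\ \Delta_2,\ \Delta_1+\Delta_2\}$$ for all but finitely many indices $k\in\mathbb{N}$. -/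

import Mathlib

open Polynomial

/-- A Pisot number: a real algebraic integer `β > 1` all of whose other Galois conjugates
(complex roots of its minimal polynomial over `ℚ`) have modulus strictly less than `1`. -/
def IsPisot (β : ℝ) : Prop :=
  1 < β ∧ IsIntegral ℤ β ∧
    ∀ z : ℂ, aeval z (minpoly ℚ β) = 0 → z ≠ (β : ℂ) → ‖z‖ < 1

/-- A quadratic Pisot unit: a Pisot number of degree `2` over `ℚ` that is a unit in the ring of
algebraic integers, that is, whose inverse is an algebraic integer as well. -/
def IsQuadraticPisotUnit (β : ℝ) : Prop :=
  IsPisot β ∧ (minpoly ℚ β).natDegree = 2 ∧ IsIntegral ℤ β⁻¹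

/-- The spectrum `X^m(β) = {∑_{j=0}^n a_j β^j : n ∈ ℕ, a_j ∈ {0,1,…,m}}`. -/
def pisotSpectrum (m : ℕ) (β : ℝ) : Set ℝ :=
  {x | ∃ (n : ℕ) (a : ℕ → ℕ), (∀ j ≤ n, a j ≤ m) ∧
    x = ∑ j ∈ Finset.range (n + 1), (a j : ℝ) * β ^ j}

/-! ### The ring `ℤ[β]` with its conjugation -/

/-! Conjugation `β ↦ γ = ±β⁻¹` turns `∑ a_j β^j` into `∑ a_j γ^j`, so the conjugates of the spectrum
lie in a bounded window with ends `l < r`. Conversely, a large `z ∈ ℤ[β]` whose conjugate `w` keeps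
a distance `δ` from both ends is in the spectrum: subtract a digit `d` and divide by `β`, so that
`(z, w)` becomes `(β⁻¹ (z - d), γ⁻¹ (w - d))`. As `m > β - 1`, there are enough digits to keep the
new conjugate in the window (`mem_pisotSpectrum_of_conj_le`, `mem_pisotSpectrum_of_conj_mem_Icc`).

The spectrum is thus, far out, a cut-and-project set except near the ends of its window. A three-gap
argument (`gap_mem_of_window`) gives the gaps from a basis of `ℤ[β]` adapted to the window length
(`exists_basis_of_window_length`). Both conjugate steps are strictly shorter than the window, which
leaves room for a margin `δ`; what happens inside the margin is then irrelevant. -/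

/-- `z = p + q β` and `w = p + q γ` for some integers `p`, `q`. -/
def ConjPair (β γ z w : ℝ) : Prop :=
  ∃ p q : ℤ, z = p + q * β ∧ w = p + q * γ

namespace ConjPair

variable {β γ z w y v : ℝ} {a c : ℤ}

theorem zero : ConjPair β γ 0 0 := ⟨0, 0, by simp, by simp⟩

theorem add (h : ConjPair β γ z w) (h' : ConjPair β γ y v) :
    ConjPair β γ (z + y) (w + v) := by
  obtain ⟨p, q, rfl, rfl⟩ := h
  obtain ⟨p', q', rfl, rfl⟩ := h'
  exact ⟨p + p', q + q', by push_cast; ring, by push_cast; ring⟩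

theorem sub (h : ConjPair β γ z w) (h' : ConjPair β γ y v) :
    ConjPair β γ (z - y) (w - v) := by
  obtain ⟨p, q, rfl, rfl⟩ := h
  obtain ⟨p', q', rfl, rfl⟩ := h'
  exact ⟨p - p', q - q', by push_cast; ring, by push_cast; ring⟩

theorem intCast (n : ℤ) : ConjPair β γ n n := ⟨n, 0, by simp, by simp⟩

theorem natCast (n : ℕ) : ConjPair β γ n n := ⟨n, 0, by simp, by simp⟩

theorem self : ConjPair β γ β γ := ⟨0, 1, by simp, by simp⟩

theorem mul_left (hs : β + γ = a) (hp : β * γ = c) (h : ConjPair β γ z w) :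
    ConjPair β γ (β * z) (γ * w) := by
  obtain ⟨p, q, rfl, rfl⟩ := h
  refine ⟨-(c * q), p + a * q, ?_, ?_⟩ <;> push_cast <;> rw [← hs, ← hp] <;> ring

theorem inv_mul (hs : β + γ = a) (hp : β * γ = c) (hc : c * c = 1) (h : ConjPair β γ z w) :
    ConjPair β γ (β⁻¹ * z) (γ⁻¹ * w) := by
  have hc' : (c : ℝ) * c = 1 := by exact_mod_cast hc
  have hβ : β⁻¹ = c * γ := by
    apply inv_eq_of_mul_eq_one_right
    rw [← hc', ← hp]; ring
  have hγ : γ⁻¹ = c * β := by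
    apply inv_eq_of_mul_eq_one_right
    rw [← hc', ← hp]; ring
  obtain ⟨p, q, rfl, rfl⟩ := h
  refine ⟨c * (a * p) + q, -(c * p), ?_, ?_⟩
  · rw [hβ]; push_cast; rw [← hs]
    linear_combination (c : ℝ) * q * hp + (q : ℝ) * hc'
  · rw [hγ]; push_cast; rw [← hs]
    linear_combination (c : ℝ) * q * hp + (q : ℝ) * hc'

theorem zpow_mul (hs : β + γ = a) (hp : β * γ = c) (hc : c * c = 1) (h : ConjPair β γ z w)
    (k : ℤ) : ConjPair β γ (β ^ k * z) (γ ^ k * w) := by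
  have h0 : β * γ ≠ 0 := by
    rw [hp]; intro h; have : c = 0 := by exact_mod_cast h
    simp [this] at hc
  have hβ := left_ne_zero_of_mul h0
  have hγ := right_ne_zero_of_mul h0
  induction k using Int.induction_on with
  | zero => simpa using h
  | succ n ih =>
    have := ih.mul_left hs hp
    rwa [← mul_assoc, ← mul_assoc, mul_comm β, mul_comm γ, ← zpow_add_one₀ hβ,
      ← zpow_add_one₀ hγ] at this
  | pred n ih =>
    have := ih.inv_mul hs hp hc
    rwa [← mul_assoc, ← mul_assoc, mul_comm β⁻¹, mul_comm γ⁻¹, ← zpow_sub_one₀ hβ,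
      ← zpow_sub_one₀ hγ] at this

end ConjPair

/-! ### Basic properties of the spectrum -/

section Spectrum

variable {m : ℕ} {β : ℝ}

theorem zero_mem_pisotSpectrum : (0 : ℝ) ∈ pisotSpectrum m β :=
  ⟨0, fun _ => 0, by simp, by simp⟩

theorem digit_add_mul_mem_pisotSpectrum {d : ℕ} (hd : d ≤ m) {z : ℝ}
    (hz : z ∈ pisotSpectrum m β) : d + β * z ∈ pisotSpectrum m β := by
  obtain ⟨n, a, ha, rfl⟩ := hz
  refine ⟨n + 1, fun j => Nat.casesOn j d a, fun j hj => ?_, ?_⟩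
  · cases j with
    | zero => exact hd
    | succ j => exact ha j (by omega)
  · rw [Finset.sum_range_succ' _ (n + 1), Finset.mul_sum]
    simp only [pow_zero, mul_one]
    rw [add_comm]
    congr 1
    exact Finset.sum_congr rfl fun j _ => by ring

theorem natCast_mem_pisotSpectrum {d : ℕ} (hd : d ≤ m) : (d : ℝ) ∈ pisotSpectrum m β := by
  simpa using digit_add_mul_mem_pisotSpectrum (β := β) hd zero_mem_pisotSpectrum

theorem mem_pisotSpectrum_of_div (hβ : β ≠ 0) {d : ℕ} (hd : d ≤ m) {z : ℝ}
    (hz : β⁻¹ * (z - d) ∈ pisotSpectrum m β) : z ∈ pisotSpectrum m β := by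
  have := digit_add_mul_mem_pisotSpectrum hd hz
  rwa [mul_inv_cancel_left₀ hβ, add_sub_cancel] at this

theorem pisotSpectrum_induction {P : ℝ → Prop} (h0 : P 0)
    (h : ∀ (d : ℕ) (z : ℝ), d ≤ m → P z → P (d + β * z)) {x : ℝ}
    (hx : x ∈ pisotSpectrum m β) : P x := by
  have key : ∀ (N : ℕ) (a : ℕ → ℕ), (∀ j < N, a j ≤ m) →
      P (∑ j ∈ Finset.range N, (a j : ℝ) * β ^ j) := by
    intro N
    induction N with
    | zero => intro a _; simpa using h0
    | succ N ih =>
      intro a ha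
      have := h (a 0) _ (ha 0 (by omega)) (ih (fun j => a (j + 1)) fun j hj => ha _ (by omega))
      rw [Finset.sum_range_succ']
      convert this using 1
      rw [Finset.mul_sum, add_comm]
      simp only [pow_zero, mul_one]
      congr 1
      exact Finset.sum_congr rfl fun j _ => by ring
  obtain ⟨n, a, ha, rfl⟩ := hx
  exact key _ a fun j hj => ha j (by omega)

theorem pow_mem_pisotSpectrum (hm : 1 ≤ m) (n : ℕ) : β ^ n ∈ pisotSpectrum m β := by
  induction n with
  | zero => simpa using natCast_mem_pisotSpectrum (β := β) hm
  | succ n ih =>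
    simpa [pow_succ'] using digit_add_mul_mem_pisotSpectrum (Nat.zero_le m) ih

theorem exists_digit_of_mem_pisotSpectrum {x : ℝ} (hx : x ∈ pisotSpectrum m β) :
    ∃ d ≤ m, ∃ z ∈ pisotSpectrum m β, x = d + β * z := by
  refine (pisotSpectrum_induction (P := fun x => x ∈ pisotSpectrum m β ∧
    ∃ d ≤ m, ∃ z ∈ pisotSpectrum m β, x = d + β * z) ?_ ?_ hx).2
  · exact ⟨zero_mem_pisotSpectrum, 0, Nat.zero_le _, 0, zero_mem_pisotSpectrum, by simp⟩
  · rintro d z hd ⟨hz, -⟩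
    exact ⟨digit_add_mul_mem_pisotSpectrum hd hz, d, hd, z, hz, rfl⟩

theorem eq_zero_or_one_le_of_mem_pisotSpectrum (hβ : 1 < β) {x : ℝ}
    (hx : x ∈ pisotSpectrum m β) : x = 0 ∨ 1 ≤ x := by
  refine pisotSpectrum_induction (P := fun x => x = 0 ∨ 1 ≤ x) (Or.inl rfl) ?_ hx
  rintro d z - (rfl | hz)
  · rcases Nat.eq_zero_or_pos d with rfl | hd
    · simp
    · right; have : (1 : ℝ) ≤ d := Nat.one_le_cast.2 hd
      simpa using this
  · right
    have : (0 : ℝ) ≤ d := d.cast_nonneg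
    nlinarith

theorem finite_pisotSpectrum_inter_Iic (hβ : 1 < β) (C : ℝ) :
    (pisotSpectrum m β ∩ Set.Iic C).Finite := by
  have hβ0 : 0 < β := by linarith
  have key : ∀ n : ℕ, ∀ C < β ^ n, (pisotSpectrum m β ∩ Set.Iic C).Finite := by
    intro n
    induction n with
    | zero =>
      intro C hC
      refine (Set.finite_singleton (0 : ℝ)).subset ?_
      rintro x ⟨hx, hxC⟩
      refine (eq_zero_or_one_le_of_mem_pisotSpectrum hβ hx).resolve_right fun h => ?_
      rw [pow_zero] at hC
      exact absurd (h.trans hxC) (not_le.2 hC)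
    | succ n ih =>
      intro C hC
      have hf := ih (C / β) (by rwa [div_lt_iff₀ hβ0, ← pow_succ])
      refine (((Set.finite_Iic m).prod hf).image
        fun t : ℕ × ℝ => (t.1 : ℝ) + β * t.2).subset ?_
      rintro x ⟨hx, hxC⟩
      obtain ⟨d, hd, z, hz, rfl⟩ := exists_digit_of_mem_pisotSpectrum hx
      refine ⟨(d, z), ⟨hd, hz, ?_⟩, rfl⟩
      have hd0 : (0 : ℝ) ≤ d := d.cast_nonneg
      have hxC' : d + β * z ≤ C := hxC
      show z ≤ C / β
      rw [le_div_iff₀ hβ0]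
      linarith
  obtain ⟨n, hn⟩ := pow_unbounded_of_one_lt C hβ
  exact key n C hn

/-- A set of reals that is unbounded above and meets every half-line `(-∞, C]` in a finite set
is the range of a strictly increasing sequence. -/
theorem exists_strictMono_range_eq {X : Set ℝ} (hfin : ∀ C, (X ∩ Set.Iic C).Finite)
    (hunb : ∀ C, ∃ x ∈ X, C < x) : ∃ y : ℕ → ℝ, StrictMono y ∧ Set.range y = X := by
  classical
  have hinf : X.Infinite := fun h => by
    obtain ⟨C, hC⟩ := h.bddAbove
    obtain ⟨x, hx, hlt⟩ := hunb C
    exact absurd (hC hx) (not_le.2 hlt)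
  let : LocallyFiniteOrder X := LocallyFiniteOrder.ofFiniteIcc fun a b =>
    Set.Finite.of_finite_image (f := Subtype.val)
      ((hfin b).subset (by rintro _ ⟨c, hc, rfl⟩; exact ⟨c.2, hc.2⟩))
      Subtype.val_injective.injOn
  have : NoMaxOrder X := ⟨fun a => by
    obtain ⟨x, hx, hlt⟩ := hunb a
    exact ⟨⟨x, hx⟩, hlt⟩⟩
  obtain ⟨x₀, hx₀, -⟩ := hunb 0
  obtain ⟨b, ⟨hb, hb₀⟩, hmin⟩ := Set.exists_min_image _ id (hfin x₀)
    ⟨x₀, hx₀, Set.mem_Iic.2 le_rfl⟩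
  let : OrderBot X :=
    { bot := ⟨b, hb⟩
      bot_le := fun a => by
        rcases le_total (a : ℝ) x₀ with h | h
        · exact hmin a ⟨a.2, h⟩
        · exact (show b ≤ x₀ from hb₀).trans h }
  let : SuccOrder X := LinearLocallyFiniteOrder.succOrder X
  let : PredOrder X := LinearLocallyFiniteOrder.predOrder X
  let e : X ≃o ℕ := orderIsoNatOfLinearSuccPredArch
  refine ⟨fun n => e.symm n, fun i j hij => e.symm.strictMono hij, ?_⟩
  have := e.symm.surjective.range_comp (Subtype.val : X → ℝ)
  rw [Subtype.range_coe] at this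
  exact this

end Spectrum

/-! ### Gaps of cut-and-project sets in `ℤ[β]` -/

/-- Two steps `Δ₁`, `Δ₂` of a cut-and-project set with conjugates `Δ₁' > 0` and `-Δ₂' < 0`
determine the gaps of every set that agrees with it up to points near the ends of the window. -/
theorem gap_mem_of_window {X : Set ℝ} {P : ℝ → ℝ → Prop} {l r Δ₁ Δ₂ Δ₁' Δ₂' δ C : ℝ}
    (hX : ∀ z ∈ X, ∃ w, P z w ∧ l ≤ w ∧ w < r)
    (hmid : ∀ z w, P z w → C ≤ z → l + δ ≤ w → w ≤ r - δ → z ∈ X)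
    (h₁ : ∀ z w, P z w → P (z + Δ₁) (w + Δ₁'))
    (h₂ : ∀ z w, P z w → P (z + Δ₂) (w - Δ₂'))
    (hgen : ∀ z w y v, P z w → P y v →
      ∃ p q : ℤ, y - z = p * Δ₁ + q * Δ₂ ∧ v - w = p * Δ₁' - q * Δ₂')
    (hΔ₁ : 0 < Δ₁) (hΔ₂ : 0 < Δ₂) (hδ : 0 < δ) (hδ₁ : δ ≤ Δ₁') (hδ₂ : δ ≤ Δ₂')
    (hs₁ : Δ₁' + 2 * δ ≤ r - l) (hs₂ : Δ₂' + 2 * δ ≤ r - l) (hlen : r - l ≤ Δ₁' + Δ₂')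
    {z y : ℝ} (hz : z ∈ X) (hCz : C ≤ z) (hy : y ∈ X) (hzy : z < y)
    (hcov : ∀ x ∈ X, z < x → y ≤ x) :
    y - z = Δ₁ ∨ y - z = Δ₂ ∨ y - z = Δ₁ + Δ₂ := by
  obtain ⟨w, hPz, hlw, hwr⟩ := hX z hz
  obtain ⟨v, hPy, hlv, hvr⟩ := hX y hy
  obtain ⟨p, q, hd, hd'⟩ := hgen z w y v hPz hPy
  -- Each of `z + Δ₁`, `z + Δ₂`, `z + Δ₁ + Δ₂` bounds the next point once its conjugate avoids the
  -- margins; if the first two fail, the third succeeds.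
  have c₁ : w + Δ₁' ≤ r - δ → y - z ≤ Δ₁ := fun h => by
    have := hcov _ (hmid _ _ (h₁ _ _ hPz) (by linarith) (by linarith) h) (by linarith)
    linarith
  have c₂ : l + δ ≤ w - Δ₂' → y - z ≤ Δ₂ := fun h => by
    have := hcov _ (hmid _ _ (h₂ _ _ hPz) (by linarith) h (by linarith)) (by linarith)
    linarith
  have c₃ : r - δ < w + Δ₁' → w - Δ₂' < l + δ → y - z ≤ Δ₁ + Δ₂ := fun h h' => by
    have := hcov _ (hmid _ _ (h₂ _ _ (h₁ _ _ hPz)) (by linarith) (by linarith) (by linarith))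
      (by linarith)
    linarith
  have hΔ₁' : 0 < Δ₁' := by linarith
  have hΔ₂' : 0 < Δ₂' := by linarith
  -- Conjugates in the window differ by less than `Δ₁' + Δ₂'`, so `p` and `q` cannot have strictly
  -- opposite signs.
  rcases le_or_gt p 0 with hp | hp <;> rcases le_or_gt q 0 with hq | hq
  · have hp' : (p : ℝ) ≤ 0 := by exact_mod_cast hp
    have hq' : (q : ℝ) ≤ 0 := by exact_mod_cast hq
    nlinarith
  · have hp' : (p : ℝ) ≤ 0 := by exact_mod_cast hp
    have hq' : (1 : ℝ) ≤ q := by exact_mod_cast hq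
    have hp0 : p = 0 := by
      by_contra hne
      have : (p : ℝ) ≤ -1 := by exact_mod_cast (show p ≤ -1 by omega)
      nlinarith
    subst hp0
    right; left
    rcases eq_or_lt_of_le (show (1 : ℤ) ≤ q from hq) with rfl | hq2
    · simpa using hd
    -- If `q ≥ 2`, then `w - Δ₂'` is at least `Δ₂' ≥ δ` above `l`, so `z + Δ₂` would come before
    -- `y`.
    · have : (2 : ℝ) ≤ q := by exact_mod_cast (show 2 ≤ q by omega)
      have := c₂ (by push_cast at hd'; nlinarith)
      push_cast at hd
      nlinarith
  · have hp' : (1 : ℝ) ≤ p := by exact_mod_cast hp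
    have hq' : (q : ℝ) ≤ 0 := by exact_mod_cast hq
    have hq0 : q = 0 := by
      by_contra hne
      have : (q : ℝ) ≤ -1 := by exact_mod_cast (show q ≤ -1 by omega)
      nlinarith
    subst hq0
    left
    rcases eq_or_lt_of_le (show (1 : ℤ) ≤ p from hp) with rfl | hp2
    · simpa using hd
    · have : (2 : ℝ) ≤ p := by exact_mod_cast (show 2 ≤ p by omega)
      have := c₁ (by push_cast at hd'; nlinarith)
      push_cast at hd
      nlinarith
  · have hp' : (1 : ℝ) ≤ p := by exact_mod_cast hp
    have hq' : (1 : ℝ) ≤ q := by exact_mod_cast hq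
    right; right
    have hge : Δ₁ + Δ₂ ≤ y - z := by nlinarith
    rcases le_or_gt (w + Δ₁') (r - δ) with h | h
    · linarith [c₁ h]
    · rcases le_or_gt (l + δ) (w - Δ₂') with h' | h'
      · linarith [c₂ h']
      · exact le_antisymm (c₃ h h') hge

/-- For every window length `ℓ` the ring `ℤ[β]` has a basis of positive elements whose conjugates
have opposite signs `s`, `-s`, are shorter than `ℓ`, and have lengths adding up to at least `ℓ`. -/
theorem exists_basis_of_window_length {β γ : ℝ} {a c : ℤ} (hβ : 1 < β) (hs : β + γ = a)
    (hp : β * γ = c) (hc : c * c = 1) {ℓ : ℝ} (hℓ : 0 < ℓ) :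
    ∃ s Δ₁ Δ₂ Δ₁' Δ₂' : ℝ, (s = 1 ∨ s = -1) ∧ 0 < Δ₁ ∧ 0 < Δ₂ ∧ 0 < Δ₁' ∧ 0 < Δ₂' ∧
      Δ₁' < ℓ ∧ Δ₂' < ℓ ∧ ℓ ≤ Δ₁' + Δ₂' ∧
      ConjPair β γ Δ₁ (s * Δ₁') ∧ ConjPair β γ Δ₂ (-(s * Δ₂')) ∧
      ∀ z w, ConjPair β γ z w →
        ∃ p q : ℤ, z = p * Δ₁ + q * Δ₂ ∧ w = p * (s * Δ₁') - q * (s * Δ₂') := by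
  have hβ0 : 0 < β := by linarith
  have hγabs : |γ| = β⁻¹ := by
    have hc1 : |(c : ℝ)| = 1 := by
      rcases mul_self_eq_one_iff.1 hc with rfl | rfl <;> simp
    apply eq_inv_of_mul_eq_one_right
    rw [← hc1, ← hp, abs_mul, abs_of_pos hβ0]
  have hγ0 : γ ≠ 0 := by
    rw [← abs_pos, hγabs]; positivity
  have hγ1 : γ < 1 := by
    have : |γ| < 1 := by rw [hγabs]; exact inv_lt_one_of_one_lt₀ hβ
    exact (abs_lt.1 this).2
  -- Scaling by the unit `β ^ k` reduces to a window of length `L ∈ (1, β]`.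
  obtain ⟨k, hk, hk'⟩ := exists_mem_Ioc_zpow hℓ hβ
  have hkpos : 0 < β ^ k := zpow_pos hβ0 k
  set L := ℓ / β ^ k with hL
  have hL1 : 1 < L := by rwa [hL, one_lt_div hkpos]
  have hLβ : L ≤ β := by
    rw [hL, div_le_iff₀ hkpos, ← zpow_one_add₀ hβ0.ne', add_comm]; exact hk'
  have hℓL : ℓ = β ^ k * L := by rw [hL]; field_simp
  -- The largest integer below `L + γ`: the basis `1`, `β - n` has conjugates of lengths `1` and `n
  -- - γ`, with `n - γ < L ≤ 1 + (n - γ)`.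
  set n : ℤ := ⌈L + γ⌉ - 1 with hn
  have hn1 : (n : ℝ) < L + γ := by
    have := Int.ceil_lt_add_one (L + γ); rw [hn]; push_cast; linarith
  have hn2 : L + γ ≤ n + 1 := by
    have := Int.le_ceil (L + γ); rw [hn]; push_cast; linarith
  -- Integrality improves `n < β + γ = a` to `n ≤ a - 1 < β`.
  have hnβ : (n : ℝ) < β := by
    have : (n : ℝ) < a := by linarith
    have : (n : ℝ) + 1 ≤ a := by exact_mod_cast (Int.cast_lt.1 this)
    linarith
  have hγk : |γ ^ (-k)| = β ^ k := by
    rw [abs_zpow, hγabs, inv_zpow', neg_neg]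
  obtain ⟨s, hs1, hsγ⟩ : ∃ s : ℝ, (s = 1 ∨ s = -1) ∧ γ ^ (-k) = s * β ^ k := by
    rcases abs_choice (γ ^ (-k)) with h | h
    · exact ⟨1, Or.inl rfl, by rw [← hγk, h, one_mul]⟩
    · exact ⟨-1, Or.inr rfl, by rw [← hγk, h]; ring⟩
  have hu : 0 < β ^ (-k) := zpow_pos hβ0 _
  refine ⟨s, β ^ (-k), β ^ (-k) * (β - n), β ^ k, β ^ k * (n - γ), hs1, hu,
    mul_pos hu (by linarith), hkpos, mul_pos hkpos (by linarith), hk, ?_, ?_, ?_, ?_, ?_⟩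
  · rw [hℓL]; exact mul_lt_mul_of_pos_left (by linarith) hkpos
  · rw [hℓL]; nlinarith
  · have := (ConjPair.intCast (β := β) (γ := γ) 1).zpow_mul hs hp hc (-k)
    rw [hsγ] at this
    simpa using this
  · have := (ConjPair.self.sub (ConjPair.intCast (β := β) (γ := γ) n)).zpow_mul hs hp hc (-k)
    rw [hsγ] at this
    convert this using 1
    ring
  · intro z w h
    obtain ⟨p, q, hz, hw⟩ := h.zpow_mul hs hp hc k
    refine ⟨p + q * n, q, ?_, ?_⟩
    · have : z = β ^ (-k) * (β ^ k * z) := by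
        rw [zpow_neg, inv_mul_cancel_left₀ hkpos.ne']
      rw [this, hz]; push_cast; ring
    · have : w = γ ^ (-k) * (γ ^ k * w) := by
        rw [zpow_neg, inv_mul_cancel_left₀ (zpow_ne_zero k hγ0)]
      rw [this, hw, hsγ]; push_cast; ring

/-- The gaps of a subset of `ℤ[β]` that agrees, far out, with the cut-and-project set of the
window `[l, r)` up to points near the ends of the window. -/
theorem exists_gaps_of_window {β γ : ℝ} {a c : ℤ} (hβ : 1 < β) (hs : β + γ = a)
    (hp : β * γ = c) (hc : c * c = 1) {X : Set ℝ} {l r : ℝ} (hlr : l < r)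
    (hX : ∀ z ∈ X, ∃ w, ConjPair β γ z w ∧ l ≤ w ∧ w < r)
    (hmid : ∀ δ > 0, ∃ C, ∀ z w, ConjPair β γ z w → C ≤ z → l + δ ≤ w → w ≤ r - δ → z ∈ X) :
    ∃ Δ₁ Δ₂ C : ℝ, 0 < Δ₁ ∧ 0 < Δ₂ ∧ ∀ z ∈ X, C ≤ z → ∀ y ∈ X, z < y →
      (∀ x ∈ X, z < x → y ≤ x) → y - z = Δ₁ ∨ y - z = Δ₂ ∨ y - z = Δ₁ + Δ₂ := by
  obtain ⟨s, Δ₁, Δ₂, Δ₁', Δ₂', hs1, hΔ₁, hΔ₂, hΔ₁', hΔ₂', hl₁, hl₂, hsum, hP₁, hP₂, hgen⟩ :=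
    exists_basis_of_window_length hβ hs hp hc (sub_pos.2 hlr)
  obtain ⟨δ, hδ, hδ₁, hδ₂, hs₁, hs₂⟩ : ∃ δ > 0, δ ≤ Δ₁' ∧ δ ≤ Δ₂' ∧
      Δ₁' + 2 * δ ≤ r - l ∧ Δ₂' + 2 * δ ≤ r - l := by
    refine ⟨min (min Δ₁' Δ₂') (min ((r - l - Δ₁') / 2) ((r - l - Δ₂') / 2)), ?_, ?_, ?_, ?_, ?_⟩
    · refine lt_min (lt_min hΔ₁' hΔ₂') (lt_min ?_ ?_) <;> linarith
    · exact (min_le_left _ _).trans (min_le_left _ _)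
    · exact (min_le_left _ _).trans (min_le_right _ _)
    · have := (min_le_right (min Δ₁' Δ₂') (min ((r - l - Δ₁') / 2) ((r - l - Δ₂') / 2))).trans
        (min_le_left _ _)
      linarith
    · have := (min_le_right (min Δ₁' Δ₂') (min ((r - l - Δ₁') / 2) ((r - l - Δ₂') / 2))).trans
        (min_le_right _ _)
      linarith
  obtain ⟨C, hC⟩ := hmid δ hδ
  refine ⟨Δ₁, Δ₂, C, hΔ₁, hΔ₂, fun z hz hCz y hy hzy hcov => ?_⟩
  rcases hs1 with rfl | rfl
  · exact gap_mem_of_window hX hC (fun z w h => by simpa using h.add hP₁)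
      (fun z w h => by simpa [sub_eq_add_neg] using h.add hP₂)
      (fun z w y v h h' => by simpa using hgen _ _ (h'.sub h))
      hΔ₁ hΔ₂ hδ hδ₁ hδ₂ hs₁ hs₂ hsum hz hCz hy hzy hcov
  -- For `s = -1` the two steps exchange roles.
  · rcases gap_mem_of_window hX hC (fun z w h => by simpa using h.add hP₂)
      (fun z w h => by simpa [sub_eq_add_neg] using h.add hP₁)
      (fun z w y v h h' => by
        obtain ⟨p, q, h1, h2⟩ := hgen _ _ (h'.sub h)
        exact ⟨q, p, by rw [h1]; ring, by rw [h2]; ring⟩)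
      hΔ₂ hΔ₁ hδ hδ₂ hδ₁ hs₂ hs₁ (by linarith) hz hCz hy hzy hcov with h | h | h
    · exact Or.inr (Or.inl h)
    · exact Or.inl h
    · exact Or.inr (Or.inr (by rw [h, add_comm]))

/-! ### Conjugation with `β γ = 1` -/

section NormOne

variable {m : ℕ} {β γ r : ℝ} {a : ℤ}

/-- The digit `d = ⌊w⌋` is at most `m` and sends `w` to `β (w - d) ∈ [0, β)`. The descent ends
because the coefficient of `β` stays nonnegative and shrinks by at least the factor `γ`. -/
theorem mem_pisotSpectrum_of_conj_lt (hβ : 1 < β) (hs : β + γ = a) (hp : β * γ = 1)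
    (hm : β - 1 < m) {z w : ℝ} (h : ConjPair β γ z w) (hz : 0 ≤ z) (hw : 0 ≤ w) (hwβ : w < β) :
    z ∈ pisotSpectrum m β := by
  have hβ0 : 0 < β := by linarith
  have hγ : γ = β⁻¹ := eq_inv_of_mul_eq_one_right hp
  have hγ0 : 0 < γ := by rw [hγ]; positivity
  have hγ1 : γ < 1 := by rw [hγ]; exact inv_lt_one_of_one_lt₀ hβ
  have hβ2 : 2 < β := by
    have h2 : (2 : ℝ) < a := by rw [← hs]; nlinarith
    have h3 : (3 : ℝ) ≤ a := by exact_mod_cast (show (2 : ℤ) < a by exact_mod_cast h2)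
    linarith
  -- For `q = -1`, `p` would be an integer strictly between `a - 1` and `a`.
  have hq0 : ∀ p q : ℤ, 0 ≤ p + q * β → p + q * γ < β → 0 ≤ q := by
    intro p q hz hw
    by_contra! hq
    rcases eq_or_lt_of_le (show q ≤ -1 by omega) with rfl | hq'
    · push_cast at hz hw
      have h1 : a - 1 < p := by
        have : (a : ℝ) - 1 < p := by linarith
        exact_mod_cast this
      have h2 : p < a := by
        have : (p : ℝ) < a := by linarith
        exact_mod_cast this
      omega
    · have : (q : ℝ) ≤ -2 := by exact_mod_cast (show q ≤ -2 by omega)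
      nlinarith
  have key : ∀ n : ℕ, ∀ p q : ℤ, 0 ≤ p + q * β → 0 ≤ p + q * γ → p + q * γ < β → q ≤ n →
      p + q * β ∈ pisotSpectrum m β := by
    intro n
    induction n with
    | zero =>
      intro p q hz hw hwβ hqn
      obtain rfl : q = 0 := le_antisymm (by simpa using hqn) (hq0 p q hz hwβ)
      simp only [Int.cast_zero, zero_mul, add_zero] at hw hwβ ⊢
      lift p to ℕ using by exact_mod_cast hw
      refine natCast_mem_pisotSpectrum (Nat.lt_succ_iff.1 ?_)
      have : (p : ℝ) < m + 1 := by push_cast at hwβ; linarith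
      exact_mod_cast this
    | succ n ih =>
      intro p q hz hw hwβ hqn
      have hq : (0 : ℝ) ≤ q := by exact_mod_cast hq0 p q hz hwβ
      set z : ℝ := p + q * β with hzdef
      set w : ℝ := p + q * γ with hwdef
      have hdw := Nat.floor_le hw
      have hwd := Nat.lt_floor_add_one w
      set d := ⌊w⌋₊
      have hwz : w ≤ z := by nlinarith
      have hdm : d ≤ m := by
        have : (d : ℝ) < m + 1 := by linarith
        exact Nat.lt_succ_iff.1 (by exact_mod_cast this)
      apply mem_pisotSpectrum_of_div hβ0.ne' hdm
      have hpair : ConjPair β γ z w := ⟨p, q, rfl, rfl⟩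
      obtain ⟨p₁, q₁, h1, h2⟩ := (hpair.sub (ConjPair.natCast d)).inv_mul (c := 1) hs
        (by simpa using hp) (by norm_num)
      have hw₁ : γ⁻¹ * (w - d) = β * (w - d) := by rw [hγ, inv_inv]
      rw [hw₁] at h2
      have hz₁ : β⁻¹ * (z - d) = γ * (z - d) := by rw [hγ]
      have hlt : q₁ ≤ n := by
        have hle : (q₁ : ℝ) ≤ γ * q := by
          have e : (q₁ : ℝ) * (β - γ) = γ * (z - d) - β * (w - d) := by
            rw [← hz₁, h1, h2]; ring
          have e' : γ * q * (β - γ) = γ * (z - w) := by rw [hzdef, hwdef]; ring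
          refine le_of_mul_le_mul_right ?_ (show 0 < β - γ by linarith)
          rw [e, e']
          nlinarith
        have hn : (q : ℝ) ≤ n + 1 := by exact_mod_cast hqn
        have : (q₁ : ℝ) < n + 1 := by nlinarith
        exact Int.lt_add_one_iff.1 (by exact_mod_cast this)
      rw [h1]
      refine ih p₁ q₁ ?_ ?_ ?_ hlt
      · rw [← h1]; exact mul_nonneg (by positivity) (by linarith)
      · rw [← h2]; exact mul_nonneg hβ0.le (by linarith)
      · rw [← h2]; nlinarith
  obtain ⟨p, q, rfl, rfl⟩ := h
  exact key q.toNat p q hz hw hwβ (Int.self_le_toNat q)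

/-- The end `r` is the fixed point of `w ↦ β (w - m)`, so using the digit `m` multiplies the
distance to `r` by `β`. After finitely many such steps `w` drops below `m + 1`, and the previous
lemma applies after one more digit. The bound `C` keeps the quotients nonnegative. -/
theorem mem_pisotSpectrum_of_conj_le (hβ : 1 < β) (hs : β + γ = a) (hp : β * γ = 1)
    (hm : β - 1 < m) (hr0 : 0 < r) (hr : r = m + γ * r) {δ : ℝ} (hδ : 0 < δ) :
    ∃ C, ∀ z w, ConjPair β γ z w → C ≤ z → 0 ≤ w → w ≤ r - δ → z ∈ pisotSpectrum m β := by
  have hβ0 : 0 < β := by linarith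
  have hγ : γ = β⁻¹ := eq_inv_of_mul_eq_one_right hp
  have hγ0 : 0 < γ := by rw [hγ]; positivity
  have hγ1 : γ < 1 := by rw [hγ]; exact inv_lt_one_of_one_lt₀ hβ
  have hdiv : ∀ {z w : ℝ} (d : ℕ), ConjPair β γ z w →
      ConjPair β γ (β⁻¹ * (z - d)) (β * (w - d)) := fun d h => by
    have := (h.sub (ConjPair.natCast d)).inv_mul (c := 1) hs (by simpa using hp) (by norm_num)
    rwa [show γ⁻¹ = β by rw [hγ, inv_inv]] at this
  have key : ∀ N : ℕ, ∃ C, ∀ z w, ConjPair β γ z w → C ≤ z → 0 ≤ w → w ≤ r - r * γ ^ N →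
      z ∈ pisotSpectrum m β := by
    intro N
    induction N with
    | zero =>
      refine ⟨0, fun z w h hz hw hwr => ?_⟩
      rw [pow_zero, mul_one, sub_self] at hwr
      exact mem_pisotSpectrum_of_conj_lt hβ hs hp hm h hz hw (by linarith)
    | succ N ih =>
      obtain ⟨C, hC⟩ := ih
      refine ⟨max (m + 1) (β * C + m), fun z w h hz hw hwr => ?_⟩
      have hz1 := (le_max_left _ _).trans hz
      have hz2 := (le_max_right _ _).trans hz
      rcases lt_or_ge w (m + 1) with hwm | hwm
      · have hdw := Nat.floor_le hw
        have hwd := Nat.lt_floor_add_one w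
        have hdm : ⌊w⌋₊ ≤ m := by
          have : (⌊w⌋₊ : ℝ) < m + 1 := by linarith
          exact Nat.lt_succ_iff.1 (by exact_mod_cast this)
        refine mem_pisotSpectrum_of_div hβ0.ne' hdm (mem_pisotSpectrum_of_conj_lt hβ hs hp hm
          (hdiv _ h) (mul_nonneg (by positivity) (by linarith))
          (mul_nonneg hβ0.le (by linarith)) (by nlinarith))
      · refine mem_pisotSpectrum_of_div hβ0.ne' le_rfl (hC _ _ (hdiv _ h) ?_
          (mul_nonneg hβ0.le (by linarith)) ?_)
        · rw [← div_eq_inv_mul, le_div_iff₀ hβ0]; linarith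
        · have e : β * (r - m) = r := by
            rw [show r - m = γ * r by linarith, ← mul_assoc, hp, one_mul]
          have e' : β * (r * γ ^ (N + 1)) = r * γ ^ N := by
            rw [pow_succ]; linear_combination r * γ ^ N * hp
          nlinarith
  obtain ⟨N, hN⟩ := exists_pow_lt_of_lt_one (div_pos hδ hr0) hγ1
  rw [lt_div_iff₀ hr0] at hN
  obtain ⟨C, hC⟩ := key N
  exact ⟨C, fun z w h hz hw hwr => hC z w h hz hw (by linarith)⟩

theorem exists_conj_of_mem_pisotSpectrum (hγ : 0 ≤ γ) (hs : β + γ = a) (hp : β * γ = 1)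
    (hr0 : 0 < r) (hr : r = m + γ * r) {z : ℝ} (hz : z ∈ pisotSpectrum m β) :
    ∃ w, ConjPair β γ z w ∧ 0 ≤ w ∧ w < r := by
  have hγ0 : 0 < γ := lt_of_le_of_ne hγ fun h => by simp [← h] at hp
  refine pisotSpectrum_induction (P := fun z => ∃ w, ConjPair β γ z w ∧ 0 ≤ w ∧ w < r)
    ⟨0, ConjPair.zero, le_rfl, hr0⟩ ?_ hz
  rintro d z hd ⟨w, h, h0, hw⟩
  refine ⟨d + γ * w, (ConjPair.natCast d).add (h.mul_left (c := 1) hs (by simpa using hp)),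
    by positivity, ?_⟩
  have : (d : ℝ) ≤ m := by exact_mod_cast hd
  nlinarith

end NormOne

/-! ### Conjugation with `β γ = -1` -/

section NormNegOne

variable {m : ℕ} {β κ l r : ℝ} {a : ℤ}

/-- The interval `(-1, κ)` is what `x ↦ -β x` maps onto the core window `(-1, β)` when `β κ = 1`; it
is longer than `1`, so its integer translates overlap. The last clause serves to show `d ≤ z`. -/
theorem exists_digit_sub_mem_Ioo {w : ℝ} (hκ0 : 0 < κ) (hκ1 : κ < 1) (hw : -1 < w)
    (hwm : w < m + κ) :
    ∃ d : ℕ, d ≤ m ∧ -1 < w - d ∧ w - d < κ ∧ (d = 0 ∨ (d : ℝ) ≤ w - κ + 1) := by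
  rcases lt_or_ge w κ with h | h
  · exact ⟨0, Nat.zero_le _, by simpa, by simpa, Or.inl rfl⟩
  · have h1 := Nat.floor_le (show 0 ≤ w - κ + 1 by linarith)
    have h2 := Nat.lt_floor_add_one (w - κ + 1)
    refine ⟨⌊w - κ + 1⌋₊, ?_, by linarith, by linarith, Or.inr h1⟩
    have : (⌊w - κ + 1⌋₊ : ℝ) < m + 1 := by linarith
    exact Nat.lt_succ_iff.1 (by exact_mod_cast this)

/-- Since `β = a + κ ≤ m + κ`, every `w` in the core window has an admissible digit. Both
coefficients stay nonnegative and, away from the cases `p = 0` and `q = 0`, a step replaces `p + q`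
by `q - (a - 1) (p - d) ≤ q`. -/
theorem mem_pisotSpectrum_of_conj_mem_Ioo (hβ : 1 < β) (hs : β + -κ = a) (hp : β * κ = 1)
    (hm : β - 1 < m) {z w : ℝ} (h : ConjPair β (-κ) z w) (hz : 0 ≤ z) (hw : -1 < w)
    (hwβ : w < β) : z ∈ pisotSpectrum m β := by
  have hβ0 : 0 < β := by linarith
  have hκ : κ = β⁻¹ := eq_inv_of_mul_eq_one_right hp
  have hκ0 : 0 < κ := by rw [hκ]; positivity
  have hκ1 : κ < 1 := by rw [hκ]; exact inv_lt_one_of_one_lt₀ hβ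
  have ha1 : 1 ≤ a := by
    have : (0 : ℝ) < a := by linarith
    exact_mod_cast this
  have ham : a ≤ m := by
    have : (a : ℝ) < m + 1 := by linarith
    exact Int.lt_add_one_iff.1 (by exact_mod_cast this)
  have ham' : (a : ℝ) ≤ m := by exact_mod_cast ham
  have hq0 : ∀ p q : ℤ, 0 ≤ p + q * β → p + q * -κ < β → 0 ≤ q := by
    intro p q hz hw
    by_contra! hq
    have : (q : ℝ) ≤ -1 := by exact_mod_cast (show q ≤ -1 by omega)
    nlinarith
  have key : ∀ n : ℕ, ∀ p q : ℤ, 0 ≤ p + q * β → -1 < p + q * -κ → p + q * -κ < β →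
      p + q ≤ n → p + q * β ∈ pisotSpectrum m β := by
    intro n
    induction n with
    | zero =>
      intro p q hz hw hwβ hn
      have hq := hq0 p q hz hwβ
      have hq' : (0 : ℝ) ≤ q := by exact_mod_cast hq
      have hp0 : 0 ≤ p := by
        have : (-1 : ℝ) < p := by nlinarith
        exact Int.lt_iff_add_one_le.1 (by exact_mod_cast this)
      obtain rfl : p = 0 := by push_cast at hn; omega
      obtain rfl : q = 0 := by push_cast at hn; omega
      simpa using zero_mem_pisotSpectrum
    | succ n ih =>
      intro p q hz hw hwβ hn
      have hq := hq0 p q hz hwβ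
      have hq' : (0 : ℝ) ≤ q := by exact_mod_cast hq
      have hp0 : 0 ≤ p := by
        have : (-1 : ℝ) < p := by nlinarith
        exact Int.lt_iff_add_one_le.1 (by exact_mod_cast this)
      rcases hq.eq_or_lt with rfl | hq1
      · lift p to ℕ using hp0
        simp only [Int.cast_zero, zero_mul, add_zero, Int.cast_natCast] at hwβ ⊢
        refine natCast_mem_pisotSpectrum (Nat.lt_succ_iff.1 ?_)
        have : (p : ℝ) < m + 1 := by linarith
        exact_mod_cast this
      rcases hp0.eq_or_lt with rfl | hp1
      · lift q to ℕ using hq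
        simp only [Int.cast_zero, zero_add, Int.cast_natCast] at hw ⊢
        have hqm : q ≤ m := by
          have : (q : ℝ) < m + 1 := by nlinarith
          exact Nat.lt_succ_iff.1 (by exact_mod_cast this)
        simpa [mul_comm] using digit_add_mul_mem_pisotSpectrum (Nat.zero_le m)
          (natCast_mem_pisotSpectrum (β := β) hqm)
      obtain ⟨d, hdm, hd1, hd2, hd3⟩ := exists_digit_sub_mem_Ioo (m := m) hκ0 hκ1 hw
        (show (p : ℝ) + q * -κ < m + κ by linarith)
      have hq1' : (1 : ℝ) ≤ q := by exact_mod_cast hq1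
      have hdz : (d : ℝ) ≤ p + q * β := by
        rcases hd3 with rfl | h
        · simpa using hz
        · nlinarith
      apply mem_pisotSpectrum_of_div hβ0.ne' hdm
      have e1 : β⁻¹ * (p + q * β - d) = ((q - a * (p - d) : ℤ) : ℝ) + ((p - d : ℤ) : ℝ) * β := by
        rw [← hκ]; push_cast; rw [← hs]
        linear_combination (q : ℝ) * hp
      have e2 : -β * (p + q * -κ - d) =
          ((q - a * (p - d) : ℤ) : ℝ) + ((p - d : ℤ) : ℝ) * -κ := by
        push_cast; rw [← hs]
        linear_combination (q : ℝ) * hp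
      have g1 : 0 ≤ β⁻¹ * (p + q * β - d) := mul_nonneg (by positivity) (by linarith)
      have g2 : -1 < -β * (p + q * -κ - d) := by nlinarith
      have g3 : -β * (p + q * -κ - d) < β := by nlinarith
      rw [e1] at g1 ⊢
      rw [e2] at g2 g3
      refine ih _ _ g1 g2 g3 ?_
      have hq1 := hq0 _ _ g1 g3
      have : 0 ≤ (a - 1) * (p - d) := mul_nonneg (by omega) hq1
      push_cast at hn
      linarith
  obtain ⟨p, q, rfl, rfl⟩ := h
  exact key (p + q).toNat p q hz hw hwβ (Int.self_le_toNat _)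

/-- Digit `0` near `l` and digit `m` near `r` map each end of the window to the other and multiply
the distance to it by `β`, so finitely many steps lead into `(-1, m + κ)`, one digit away from the
core window. -/
theorem mem_pisotSpectrum_of_conj_mem_Icc (hβ : 1 < β) (hs : β + -κ = a) (hp : β * κ = 1)
    (hm : β - 1 < m) (hl0 : l < 0) (hr0 : 0 < r) (hl : l = -(κ * r)) (hr : r = m - κ * l)
    {δ : ℝ} (hδ : 0 < δ) :
    ∃ C, ∀ z w, ConjPair β (-κ) z w → C ≤ z → l + δ ≤ w → w ≤ r - δ →
      z ∈ pisotSpectrum m β := by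
  have hβ0 : 0 < β := by linarith
  have hκ : κ = β⁻¹ := eq_inv_of_mul_eq_one_right hp
  have hκ0 : 0 < κ := by rw [hκ]; positivity
  have hκ1 : κ < 1 := by rw [hκ]; exact inv_lt_one_of_one_lt₀ hβ
  have hlr : 0 < r - l := by linarith
  have hel : β * l = -r := by rw [hl]; linear_combination (-r) * hp
  have her : β * (r - m) = -l := by linear_combination β * hr - l * hp
  have hdiv : ∀ {z w : ℝ} (d : ℕ), ConjPair β (-κ) z w →
      ConjPair β (-κ) (β⁻¹ * (z - d)) (-β * (w - d)) := fun d h => by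
    have := (h.sub (ConjPair.natCast d)).inv_mul (c := -1) hs (by simp [hp]) (by norm_num)
    rwa [show (-κ)⁻¹ = -β by rw [inv_neg, hκ, inv_inv]] at this
  -- The alternatives treat the ends separately: a step taken near one end satisfies the condition
  -- at the other end through its core alternative.
  have key : ∀ N : ℕ, ∃ C, ∀ z w, ConjPair β (-κ) z w → C ≤ z →
      (-1 < w ∨ l + (r - l) * κ ^ N ≤ w) → (w < m + κ ∨ w ≤ r - (r - l) * κ ^ N) →
      z ∈ pisotSpectrum m β := by
    have good : ∀ z w, ConjPair β (-κ) z w → (m : ℝ) ≤ z → -1 < w → w < m + κ →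
        z ∈ pisotSpectrum m β := by
      intro z w h hz hw hwm
      obtain ⟨d, hdm, hd1, hd2, -⟩ := exists_digit_sub_mem_Ioo hκ0 hκ1 hw hwm
      have hdm' : (d : ℝ) ≤ m := by exact_mod_cast hdm
      exact mem_pisotSpectrum_of_div hβ0.ne' hdm (mem_pisotSpectrum_of_conj_mem_Ioo hβ hs hp hm
        (hdiv d h) (mul_nonneg (by positivity) (by linarith)) (by nlinarith) (by nlinarith))
    have hm0 : (0 : ℝ) ≤ m := m.cast_nonneg
    intro N
    induction N with
    | zero =>
      refine ⟨m, fun z w h hz hw hwm => good z w h hz ?_ ?_⟩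
      · rcases hw with hw | hw
        · exact hw
        · rw [pow_zero] at hw; linarith
      · rcases hwm with hw | hw
        · exact hw
        · rw [pow_zero] at hw; linarith
    | succ N ih =>
      obtain ⟨C, hC⟩ := ih
      have hpow : β * ((r - l) * κ ^ (N + 1)) = (r - l) * κ ^ N := by
        rw [pow_succ]; linear_combination (r - l) * κ ^ N * hp
      refine ⟨max m (β * C + m), fun z w h hz hw hwm => ?_⟩
      have hz1 := (le_max_left _ _).trans hz
      have hz2 := (le_max_right _ _).trans hz
      rcases le_or_gt w (-1) with h1 | h1
      · have hw' := hw.resolve_left (not_lt.2 h1)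
        refine mem_pisotSpectrum_of_div hβ0.ne' (Nat.zero_le m)
          (hC _ _ (hdiv 0 h) ?_ (Or.inl ?_) (Or.inr ?_))
        · rw [← div_eq_inv_mul, le_div_iff₀ hβ0]; push_cast; linarith
        · push_cast; nlinarith
        · push_cast; nlinarith
      rcases le_or_gt ((m : ℝ) + κ) w with h2 | h2
      · have hw' := hwm.resolve_left (not_lt.2 h2)
        refine mem_pisotSpectrum_of_div hβ0.ne' le_rfl
          (hC _ _ (hdiv m h) ?_ (Or.inr ?_) (Or.inl ?_))
        · rw [← div_eq_inv_mul, le_div_iff₀ hβ0]; linarith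
        · nlinarith
        · nlinarith
      · exact good z w h hz1 h1 h2
  obtain ⟨N, hN⟩ := exists_pow_lt_of_lt_one (div_pos hδ hlr) hκ1
  rw [lt_div_iff₀ hlr] at hN
  obtain ⟨C, hC⟩ := key N
  exact ⟨C, fun z w h hz hw hwr => hC z w h hz (Or.inr (by linarith)) (Or.inr (by linarith))⟩

theorem exists_conj_mem_Ioo_of_mem_pisotSpectrum (hκ0 : 0 < κ) (hs : β + -κ = a)
    (hp : β * κ = 1) (hl0 : l < 0) (hr0 : 0 < r) (hl : l = -(κ * r)) (hr : r = m - κ * l)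
    {z : ℝ} (hz : z ∈ pisotSpectrum m β) : ∃ w, ConjPair β (-κ) z w ∧ l < w ∧ w < r := by
  refine pisotSpectrum_induction (P := fun z => ∃ w, ConjPair β (-κ) z w ∧ l < w ∧ w < r)
    ⟨0, ConjPair.zero, hl0, hr0⟩ ?_ hz
  rintro d z hd ⟨w, h, h0, hw⟩
  have hd' : (d : ℝ) ≤ m := by exact_mod_cast hd
  have hd0 : (0 : ℝ) ≤ d := d.cast_nonneg
  exact ⟨d + -κ * w, (ConjPair.natCast d).add (h.mul_left (c := -1) hs (by simp [hp])),
    by nlinarith, by nlinarith⟩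

end NormNegOne

/-! ### Quadratic units -/

/-- `β` is a root of the reverse of a monic `Q` that kills `β⁻¹`. Its minimal polynomial divides
that reverse, whose constant coefficient is `1`, so the norm `c` is a unit of `ℤ`. -/
theorem IsQuadraticPisotUnit.exists_conj {β : ℝ} (h : IsQuadraticPisotUnit β) :
    ∃ (γ : ℝ) (a c : ℤ), β + γ = a ∧ β * γ = c ∧ c * c = 1 := by
  obtain ⟨⟨hβ, hint, -⟩, hdeg, Q, hQ, hQ0⟩ := h
  have hdeg' : (minpoly ℤ β).natDegree = 2 := by
    rw [← hdeg, minpoly.isIntegrallyClosed_eq_field_fractions' ℚ hint,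
      (minpoly.monic hint).natDegree_map]
  have hroot : ((minpoly ℤ β).coeff 0 : ℝ) + (minpoly ℤ β).coeff 1 * β + β ^ 2 = 0 := by
    have h0 := minpoly.aeval ℤ β
    have h1 : (minpoly ℤ β).coeff 2 = 1 := by
      have := (minpoly.monic hint).coeff_natDegree
      rwa [hdeg'] at this
    rw [aeval_eq_sum_range, hdeg'] at h0
    simpa [Finset.sum_range_succ, h1] using h0
  have hdvd : minpoly ℤ β ∣ Q.reverse := by
    apply minpoly.isIntegrallyClosed_dvd hint
    have hβ0 : β ≠ 0 := by linarith
    let := invertibleOfNonzero (inv_ne_zero hβ0)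
    have := (eval₂_reverse_eq_zero_iff (algebraMap ℤ ℝ) β⁻¹ Q).2 hQ0
    rwa [invOf_eq_inv, inv_inv, ← aeval_def] at this
  obtain ⟨R, hR⟩ := hdvd
  have hunit : (minpoly ℤ β).coeff 0 * R.coeff 0 = 1 := by
    rw [← mul_coeff_zero, ← hR, coeff_zero_reverse, hQ.leadingCoeff]
  refine ⟨-(minpoly ℤ β).coeff 1 - β, -(minpoly ℤ β).coeff 1, (minpoly ℤ β).coeff 0, ?_, ?_, ?_⟩
  · push_cast; ring
  · linear_combination -hroot
  · rcases Int.isUnit_iff.1 (IsUnit.of_mul_eq_one _ hunit) with h | h <;> simp [h]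

theorem pisotSpectrum_exists_gaps {β : ℝ} (hβ : IsQuadraticPisotUnit β) {m : ℕ}
    (hm : β - 1 < m) :
    ∃ Δ₁ Δ₂ C : ℝ, 0 < Δ₁ ∧ 0 < Δ₂ ∧ ∀ z ∈ pisotSpectrum m β, C ≤ z →
      ∀ y ∈ pisotSpectrum m β, z < y → (∀ x ∈ pisotSpectrum m β, z < x → y ≤ x) →
        y - z = Δ₁ ∨ y - z = Δ₂ ∨ y - z = Δ₁ + Δ₂ := by
  have hβ1 : 1 < β := hβ.1.1
  have hβ0 : 0 < β := by linarith
  have hm0 : (0 : ℝ) < m := by linarith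
  obtain ⟨γ, a, c, hs, hp, hc⟩ := hβ.exists_conj
  rcases mul_self_eq_one_iff.1 hc with rfl | rfl
  · have hp' : β * γ = 1 := by simpa using hp
    have hγ : γ = β⁻¹ := eq_inv_of_mul_eq_one_right hp'
    have hγ0 : 0 < γ := by rw [hγ]; positivity
    have hγ1 : γ < 1 := by rw [hγ]; exact inv_lt_one_of_one_lt₀ hβ1
    -- `m / (1 - γ) = ∑ m γ^j` is the supremum of the conjugates.
    have hr0 : 0 < m / (1 - γ) := div_pos hm0 (by linarith)
    have hr : m / (1 - γ) = m + γ * (m / (1 - γ)) := by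
      have : 1 - γ ≠ 0 := by linarith
      field_simp; ring
    refine exists_gaps_of_window hβ1 hs hp hc hr0
      (fun z hz => exists_conj_of_mem_pisotSpectrum hγ0.le hs hp' hr0 hr hz) fun δ hδ => ?_
    obtain ⟨C, hC⟩ := mem_pisotSpectrum_of_conj_le hβ1 hs hp' hm hr0 hr hδ
    exact ⟨C, fun z w h hz hw hwr => hC z w h hz (by linarith) hwr⟩
  · obtain ⟨κ, rfl⟩ : ∃ κ, γ = -κ := ⟨-γ, by simp⟩
    have hp' : β * κ = 1 := by push_cast at hp; linarith
    have hκ : κ = β⁻¹ := eq_inv_of_mul_eq_one_right hp'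
    have hκ0 : 0 < κ := by rw [hκ]; positivity
    have hκ1 : κ < 1 := by rw [hκ]; exact inv_lt_one_of_one_lt₀ hβ1
    have hκ2 : 0 < 1 - κ ^ 2 := by nlinarith
    -- Here the supremum has digit `m` at even powers only, and the infimum at odd powers only.
    have hr0 : 0 < m / (1 - κ ^ 2) := div_pos hm0 hκ2
    have hl0 : -(κ * (m / (1 - κ ^ 2))) < 0 := by
      rw [neg_lt_zero]; positivity
    have hr : m / (1 - κ ^ 2) = m - κ * -(κ * (m / (1 - κ ^ 2))) := by
      field_simp; ring
    refine exists_gaps_of_window hβ1 hs hp hc (hl0.trans hr0) (fun z hz => ?_) fun δ hδ =>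
      mem_pisotSpectrum_of_conj_mem_Icc hβ1 hs hp' hm hl0 hr0 rfl hr hδ
    obtain ⟨w, h, h1, h2⟩ :=
      exists_conj_mem_Ioo_of_mem_pisotSpectrum hκ0 hs hp' hl0 hr0 rfl hr hz
    exact ⟨w, h, h1.le, h2⟩

theorem theorem1 (β : ℝ) (hβ : IsQuadraticPisotUnit β) (m : ℕ) (hm : β - 1 < (m : ℝ)) :
    ∃ y : ℕ → ℝ, StrictMono y ∧ Set.range y = pisotSpectrum m β ∧
      ∃ Δ₁ Δ₂ : ℝ, 0 < Δ₁ ∧ 0 < Δ₂ ∧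
        {k : ℕ | y (k + 1) - y k ∉ ({Δ₁, Δ₂, Δ₁ + Δ₂} : Set ℝ)}.Finite := by
  have hβ1 : 1 < β := hβ.1.1
  have hm1 : 1 ≤ m := by
    have : (0 : ℝ) < m := by linarith
    exact_mod_cast this
  have hfin := finite_pisotSpectrum_inter_Iic (m := m) hβ1
  obtain ⟨y, hy, hrange⟩ := exists_strictMono_range_eq hfin fun C => by
    obtain ⟨n, hn⟩ := pow_unbounded_of_one_lt C hβ1
    exact ⟨β ^ n, pow_mem_pisotSpectrum hm1 n, hn⟩
  obtain ⟨Δ₁, Δ₂, C, hΔ₁, hΔ₂, hgap⟩ := pisotSpectrum_exists_gaps hβ hm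
  refine ⟨y, hy, hrange, Δ₁, Δ₂, hΔ₁, hΔ₂, ?_⟩
  have hmem : ∀ k, y k ∈ pisotSpectrum m β := fun k => hrange ▸ Set.mem_range_self k
  refine ((hfin C).preimage hy.injective.injOn).subset fun k hk => ?_
  refine ⟨hmem k, ?_⟩
  by_contra hkC
  refine hk ?_
  simp only [Set.mem_insert_iff, Set.mem_singleton_iff]
  refine hgap _ (hmem k) (not_le.1 hkC).le _ (hmem (k + 1)) (hy k.lt_succ_self) ?_
  intro x hx hlt
  rw [← hrange] at hx
  obtain ⟨j, rfl⟩ := hx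
  exact hy.monotone (Nat.succ_le_of_lt (hy.lt_iff_lt.1 hlt))
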